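/- For a finite commutative ring $R$ with $1\neq 0$, the unitary Cayley graph $G_R$ has vertex set $R$, with $x,y$ adjacent if and only if $x-y$ is a unit of $R$. A finite $r$-regular graph is called Ramanujan if every eigenvalue $\lambda$ of its adjacency matrix with $\lambda\neq\pm r$ satisfies $|\lambda|\le 2\sqrt{r-1}$. $\mathbb F_q$ denotes the finite field with $q$ elements. **Theorem.** Let $s\ge 2$ and let $R=R_1\times\cdots\times R_s$, where each $R_i$ is a finite local commutative ring with maximal ideal $M_i$ of order $m_i$, and $|R_1|/m_1\le |R_2|/m_2\le\cdots\le |R_s|/m_s$. Then $G_R$ is Ramanujan if and only if, after possibly permuting among themselves factors $R_i$ having equal values of $|R_i|/m_i$, one of the following holds: (a) $R_i/M_i\cong\mathbb F_2$ for $i=1,\dots,s$; (b) $s\ge 3$, $R_i\cong\mathbb F_2$ for $i=1,\dots,s-3$, and $R_i\cong\mathbb F_3$ for $i=s-2,s-1,s$; (c) $s\ge 3$, $R_i\cong\mathbb F_2$ for $i=1,\dots,s-3$, $R_i\cong\mathbb F_3$ for $i=s-2,s-1$, and $R_s\cong\mathbb F_4$; (d) $s\ge 3$, $R_i\cong\mathbb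 F_2$ for $i=1,\dots,s-3$, and $R_i\cong\mathbb F_4$ for $i=s-2,s-1,s$; (e) $R_i\cong\mathbb F_2$ for $i=1,\dots,s-2$, $R_{s-1}\cong\mathbb F_3$, and $R_s\cong\mathbb Z_9$ or $\mathbb Z_3[X]/(X^2)$; (f) $s\ge 3$, $R_1\cong\mathbb Z_4$ or $\mathbb Z_2[X]/(X^2)$, $R_i\cong\mathbb F_2$ for $i=2,\dots,s-2$, and $R_{s-1}\cong\mathbb F_{q_1}$, $R_s\cong\mathbb F_{q_2}$ for some prime powers $q_1,q_2\ge 3$ such that $q_1\le q_2\le q_1+\sqrt{(q_1-2)q_1}$; (g) $R_i\cong\mathbb F_2$ for $i=1,\dots,s-2$, and $R_{s-1}\cong\mathbb F_{q_1}$, $R_s\cong\mathbb F_{q_2}$ for some prime powers $q_1,q_2\ge 3$ such that $q_1\le q_2\le 2\left(q_1+\sqrt{(q_1-2)q_1}\right)-1$; (h) $R_i/M_i\cong\mathbb F_2$ for $i=1,\dots,s-1$, $R_s/M_s\cong\mathbb F_q$ for some prime power $q\ge 3$, and $\prod_{i=1}^s m_i\le 2\left(q-1+\sqrt{(q-2)q}\right)$.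 -/

import Mathlib

open Polynomial

/-- The unitary Cayley graph `G_R`: distinct `a b : R` are adjacent iff `a - b` is a unit.
When `1 ≠ 0` in `R`, the requirement `a ≠ b` is automatic. -/
def unitaryCayleyGraph (R : Type*) [CommRing R] : SimpleGraph R where
  Adj a b := a ≠ b ∧ IsUnit (a - b)
  symm := ⟨fun a b h => ⟨h.1.symm, by simpa using h.2.neg⟩⟩
  loopless := ⟨fun _ h => h.1 rfl⟩

open Classical in
/-- A finite graph is Ramanujan if it is `r`-regular for some `r` and every eigenvalue of its
adjacency matrix other than `r` and `-r` has absolute value at most `2 √(r - 1)`.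
The adjacency matrix is real symmetric, so all its eigenvalues are real. -/
def IsRamanujanGraph {V : Type*} [Fintype V] (G : SimpleGraph V) : Prop :=
  ∃ r : ℕ, G.IsRegularOfDegree r ∧
    ∀ μ : ℝ, Module.End.HasEigenvalue (Matrix.toLin' (G.adjMatrix ℝ)) μ →
      μ ≠ (r : ℝ) → μ ≠ -(r : ℝ) → |μ| ≤ 2 * Real.sqrt ((r : ℝ) - 1)

/-- `A ≅ 𝔽_q`: the number `q` is a prime power `p ^ n` with `n ≥ 1`, and the ring `A` is isomorphic
to the finite field with `p ^ n` elements. -/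
def IsoFiniteField (A : Type*) [CommRing A] (q : ℕ) : Prop :=
  ∃ (p n : ℕ) (_ : Fact p.Prime), n ≠ 0 ∧ q = p ^ n ∧ Nonempty (A ≃+* GaloisField p n)

/-- The order `m = |M|` of the maximal ideal `M` of a local ring `A`. -/
noncomputable def maxIdealCard (A : Type*) [CommRing A] [IsLocalRing A] : ℕ :=
  Nat.card (IsLocalRing.maximalIdeal A)

/-- The quotient `|A| / m` for a local ring `A` with maximal ideal of order `m`. -/
noncomputable def cardRatio (A : Type*) [CommRing A] [IsLocalRing A] : ℚ :=
  (Nat.card A : ℚ) / (maxIdealCard A : ℚ)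

/-!
The adjacency matrix of a unitary Cayley graph `G_A` is a convolution operator on the additive group
of `A`, so its eigenvalues are the character sums `∑ ψ u` over the units `u`
(`hasEigenvalue_unitaryCayleyGraph_iff`). For a finite local ring with maximal ideal of order `m`
and residue field of order `q` such a sum is `m (q - 1)`, `-m` or `0`
(`sum_units_addChar_cases`), and for a product of rings the sums multiply. Hence the degree of
`G_R` is `r = ∏ m i (q i - 1)`, every eigenvalue other than `0` and `± r` is bounded in absolute
value by some `r / (q i - 1)` with `q i ≥ 3`, and each `-r / (q i - 1)` is an eigenvalue. So `G_R`
is Ramanujan iff `(r / (q i - 1)) ^ 2 + 4 ≤ 4 r` whenever `q i ≥ 3`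
(`isRamanujanGraph_unitaryCayleyGraph_pi_iff`), where only the smallest such `q i` matters.

Let `a = q i - 1` be that smallest value and write `r = a t`. The inequality `t ^ 2 + 4 ≤ 4 a t`
means `t ≤ 2 (a + √(a ^ 2 - 1))`, and in particular forces `t < 4 a`. If `k` residue fields have
order at least `3`, then `t` is the product of all `m i` and of the `k - 1` other numbers `q j - 1`,
each of which is at least `a`. This excludes `k ≥ 4`; for `k = 3` it leaves fields of orders at most
`4` and no ramification; for `k = 2` it gives `∏ m i ≤ 3`; for `k = 1` it is the bound on `∏ m i`,
and for `k = 0` there is no condition (`RamanujanCriterion.exists_admissibleOrders`,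
`AdmissibleOrders.ramanujanCriterion`).

Orders determine the rings that occur: `m = 1` means that the ring is a finite field, and by
Nakayama `q` divides `m` otherwise. Thus `∏ m i = p` with `p = 2, 3` comes from a single factor with
`m = q = p`, and such a ring is `ℤ / p ^ 2` or `𝔽_p[X] / (X ^ 2)`
(`ringEquiv_of_maxIdealCard_eq_prime`).
-/

/-! ### Spectrum of a unitary Cayley graph -/

section Spectrum

variable {A : Type*} [CommRing A] [Nontrivial A]

lemma unitaryCayleyGraph_adj {a b : A} : (unitaryCayleyGraph A).Adj a b ↔ IsUnit (a - b) := by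
  refine ⟨fun h => h.2, fun h => ⟨?_, h⟩⟩
  rintro rfl
  exact not_isUnit_zero (sub_self a ▸ h)

variable [Fintype A] [Fintype Aˣ]

open Classical in
lemma neighborFinset_unitaryCayleyGraph (a : A) :
    (unitaryCayleyGraph A).neighborFinset a = Finset.univ.image (fun u : Aˣ => a + u) := by
  ext b
  simp only [SimpleGraph.mem_neighborFinset, unitaryCayleyGraph_adj, Finset.mem_image,
    Finset.mem_univ, true_and]
  constructor
  · rintro ⟨u, hu⟩
    exact ⟨-u, by simp [hu]⟩
  · rintro ⟨u, rfl⟩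
    simp

open Classical in
lemma isRegularOfDegree_unitaryCayleyGraph :
    (unitaryCayleyGraph A).IsRegularOfDegree (Fintype.card Aˣ) := by
  intro a
  rw [← SimpleGraph.card_neighborFinset_eq_degree, neighborFinset_unitaryCayleyGraph,
    Finset.card_image_of_injective _ (fun u v h => Units.ext (add_left_cancel h)),
    Finset.card_univ]

open Classical in
lemma adjMatrix_unitaryCayleyGraph_mulVec (f : A → ℝ) (a : A) :
    Matrix.mulVec ((unitaryCayleyGraph A).adjMatrix ℝ) f a = ∑ u : Aˣ, f (a + u) := by
  rw [SimpleGraph.adjMatrix_mulVec_apply, neighborFinset_unitaryCayleyGraph,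
    Finset.sum_image (fun u _ v _ h => Units.ext (add_left_cancel h))]

open Classical in
/-- The eigenvalues are the character sums over the unit group. A real eigenvector `f` has some
nonzero Fourier coefficient, and the eigenvalue is the character sum there; conversely the real part
of a character is a nonzero eigenvector, its value at `0` being `1`. -/
lemma hasEigenvalue_unitaryCayleyGraph_iff (μ : ℝ) :
    Module.End.HasEigenvalue (Matrix.toLin' ((unitaryCayleyGraph A).adjMatrix ℝ)) μ ↔
      ∃ ψ : AddChar A ℂ, ∑ u : Aˣ, ψ u = (μ : ℂ) := by
  constructor
  · intro h
    obtain ⟨f, hf⟩ := h.exists_hasEigenvector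
    have hA : ∀ x, ∑ u : Aˣ, f (x + u) = μ * f x := by
      intro x
      rw [← adjMatrix_unitaryCayleyGraph_mulVec f]
      have := congrFun hf.apply_eq_smul x
      rw [Matrix.toLin'_apply] at this
      rw [Pi.smul_apply, smul_eq_mul] at this
      rw [← this]
    have hcoeff : ∃ ψ : AddChar A ℂ, ∑ x, ψ (-x) * (f x : ℂ) ≠ 0 := by
      by_contra! hzero
      apply hf.2
      funext y
      have : ∑ ψ : AddChar A ℂ, ψ y * ∑ x, ψ (-x) * (f x : ℂ) = 0 := by simp [hzero]
      have h2 : ∑ ψ : AddChar A ℂ, ψ y * ∑ x, ψ (-x) * (f x : ℂ)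
          = ∑ x, (∑ ψ : AddChar A ℂ, ψ (y - x)) * (f x : ℂ) := by
        simp only [Finset.mul_sum, Finset.sum_mul]
        rw [Finset.sum_comm]
        refine Finset.sum_congr rfl fun x _ => Finset.sum_congr rfl fun ψ _ => ?_
        rw [sub_eq_add_neg, AddChar.map_add_eq_mul, mul_assoc]
      rw [h2] at this
      simp only [AddChar.sum_apply_eq_ite, sub_eq_zero, ite_mul, zero_mul, Finset.sum_ite_eq,
        Finset.mem_univ, if_true, mul_eq_zero, Nat.cast_eq_zero, Fintype.card_ne_zero,
        false_or] at this
      simpa using this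
    obtain ⟨ψ, hψ⟩ := hcoeff
    refine ⟨ψ, mul_right_cancel₀ hψ ?_⟩
    have h1 : ∑ x, ψ (-x) * ((∑ u : Aˣ, f (x + u) : ℝ) : ℂ)
        = (μ : ℂ) * ∑ x, ψ (-x) * (f x : ℂ) := by
      rw [Finset.mul_sum]
      refine Finset.sum_congr rfl fun x _ => ?_
      rw [hA x]
      push_cast
      ring
    rw [← h1, Finset.sum_mul]
    simp only [Complex.ofReal_sum, Finset.mul_sum]
    rw [Finset.sum_comm (s := (Finset.univ : Finset A))]
    refine Finset.sum_congr rfl fun u _ => ?_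
    rw [← Equiv.sum_comp (Equiv.addRight (u : A))]
    refine Finset.sum_congr rfl fun x _ => ?_
    rw [← mul_assoc, ← AddChar.map_add_eq_mul]
    simp
  · rintro ⟨ψ, hψ⟩
    refine Module.End.hasEigenvalue_of_hasEigenvector (x := fun a => (ψ a).re) ⟨?_, ?_⟩
    · rw [Module.End.mem_eigenspace_iff]
      funext x
      have h1 : Matrix.toLin' ((unitaryCayleyGraph A).adjMatrix ℝ) (fun a => (ψ a).re) x
          = ∑ u : Aˣ, (ψ (x + u)).re := by
        rw [Matrix.toLin'_apply, ← adjMatrix_unitaryCayleyGraph_mulVec (fun a => (ψ a).re)]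
      rw [h1, ← Complex.re_sum]
      simp only [AddChar.map_add_eq_mul, ← Finset.mul_sum, hψ]
      simp [mul_comm]
    · intro h
      simpa using congrFun h 0

end Spectrum

/-! ### Character sums over the units of a finite local ring -/

section LocalSum

variable {A : Type*} [CommRing A] [IsLocalRing A]

lemma card_eq_maxIdealCard_mul : Nat.card A =
    maxIdealCard A * Nat.card (IsLocalRing.ResidueField A) :=
  Submodule.card_eq_card_quotient_mul_card (IsLocalRing.maximalIdeal A)

lemma maxIdealCard_pos [Finite A] : 0 < maxIdealCard A := Nat.card_pos

instance [Finite A] : Finite (IsLocalRing.ResidueField A) :=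
  Finite.of_surjective _ (IsLocalRing.residue_surjective (R := A))

lemma cardRatio_eq [Finite A] : cardRatio A = Nat.card (IsLocalRing.ResidueField A) := by
  have : (maxIdealCard A : ℚ) ≠ 0 := by exact_mod_cast (maxIdealCard_pos (A := A)).ne'
  rw [cardRatio, card_eq_maxIdealCard_mul]
  push_cast
  field_simp

lemma two_le_card_residueField [Finite A] : 2 ≤ Nat.card (IsLocalRing.ResidueField A) :=
  Finite.one_lt_card

lemma sum_maximalIdeal_addChar [Fintype (IsLocalRing.maximalIdeal A)] (ψ : AddChar A ℂ) :
    ∑ x : IsLocalRing.maximalIdeal A, ψ x = 0 ∨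
      ∑ x : IsLocalRing.maximalIdeal A, ψ x = maxIdealCard A := by
  classical
  let φ := ψ.compAddMonoidHom (IsLocalRing.maximalIdeal A).toAddSubgroup.subtype
  have h : ∑ x : IsLocalRing.maximalIdeal A, ψ x = ∑ x, φ x := rfl
  rw [h, AddChar.sum_eq_ite]
  split_ifs
  · right
    rw [maxIdealCard, Nat.card_eq_fintype_card]
    rfl
  · exact Or.inl rfl

variable [Fintype A] [Fintype Aˣ]

lemma sum_units_addChar [Fintype (IsLocalRing.maximalIdeal A)] (ψ : AddChar A ℂ) : ∑ u : Aˣ, ψ u =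
    ∑ x, ψ x - ∑ x : IsLocalRing.maximalIdeal A, ψ x := by
  classical
  rw [← Finset.sum_filter_add_sum_filter_not Finset.univ (fun x : A => IsUnit x), eq_sub_iff_add_eq]
  congr 1
  · refine Finset.sum_bij (fun u _ => (u : A)) (by simp) (fun u _ v _ h => Units.ext h) ?_ (by simp)
    intro b hb
    obtain ⟨u, rfl⟩ := (Finset.mem_filter.1 hb).2
    exact ⟨u, Finset.mem_univ _, rfl⟩
  · symm
    apply Finset.sum_subtype
    simp [IsLocalRing.mem_maximalIdeal, mem_nonunits_iff]

lemma sum_units_zero : ∑ u : Aˣ, (0 : AddChar A ℂ) u =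
    maxIdealCard A * ((Nat.card (IsLocalRing.ResidueField A) : ℂ) - 1) := by
  have : Fintype (IsLocalRing.maximalIdeal A) := Fintype.ofFinite _
  have h := card_eq_maxIdealCard_mul (A := A)
  rw [Nat.card_eq_fintype_card] at h
  rw [sum_units_addChar]
  simp only [AddChar.zero_apply, Finset.sum_const, Finset.card_univ, nsmul_eq_mul, h]
  rw [maxIdealCard, ← Nat.card_eq_fintype_card (α := IsLocalRing.maximalIdeal A)]
  push_cast
  ring

/-- The three values are taken at the trivial character, at the nontrivial characters that are
trivial on the maximal ideal, and at the remaining characters. -/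
lemma sum_units_addChar_cases (ψ : AddChar A ℂ) :
    ∑ u : Aˣ, ψ u = maxIdealCard A * ((Nat.card (IsLocalRing.ResidueField A) : ℂ) - 1) ∨
    ∑ u : Aˣ, ψ u = -(maxIdealCard A : ℂ) ∨ ∑ u : Aˣ, ψ u = 0 := by
  classical
  by_cases hψ : ψ = 0
  · left
    rw [hψ, sum_units_zero]
  · have : Fintype (IsLocalRing.maximalIdeal A) := Fintype.ofFinite _
    rw [sum_units_addChar, AddChar.sum_eq_ite, if_neg hψ]
    rcases sum_maximalIdeal_addChar ψ with h | h <;> simp [h]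

lemma card_units_eq : Fintype.card Aˣ =
    maxIdealCard A * (Nat.card (IsLocalRing.ResidueField A) - 1) := by
  have h := sum_units_zero (A := A)
  simp only [AddChar.zero_apply, Finset.sum_const, Finset.card_univ, nsmul_eq_mul, mul_one] at h
  have h2 := two_le_card_residueField (A := A)
  rw [← Nat.cast_inj (R := ℂ), h]
  push_cast [Nat.cast_sub (show 1 ≤ _ by omega : 1 ≤ Nat.card (IsLocalRing.ResidueField A))]
  ring

lemma exists_sum_units_eq_neg : ∃ ψ : AddChar A ℂ, ∑ u : Aˣ, ψ u = -(maxIdealCard A : ℂ) := by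
  classical
  have : Fintype (IsLocalRing.ResidueField A) := Fintype.ofFinite _
  have : Fintype (IsLocalRing.maximalIdeal A) := Fintype.ofFinite _
  obtain ⟨φ, hφ⟩ := (AddChar.exists_apply_ne_zero (a := (1 : IsLocalRing.ResidueField A))).2
    one_ne_zero
  let ψ : AddChar A ℂ := φ.compAddMonoidHom (IsLocalRing.residue A).toAddMonoidHom
  have happ : ∀ x, ψ x = φ (IsLocalRing.residue A x) := fun _ => rfl
  refine ⟨ψ, ?_⟩
  have hψ : ψ ≠ 0 := by
    intro h
    apply hφ
    have := DFunLike.congr_fun h 1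
    rwa [happ, map_one] at this
  rw [sum_units_addChar, AddChar.sum_eq_ite, if_neg hψ, zero_sub, neg_inj, maxIdealCard,
    Nat.card_eq_fintype_card]
  have : ∀ x : IsLocalRing.maximalIdeal A, ψ x = 1 := by
    intro x
    rw [happ, (IsLocalRing.residue_eq_zero_iff _).2 x.2, AddChar.map_zero_eq_one]
  simp [this]

end LocalSum

/-! ### Products of finite local rings -/

section Product

variable {ι : Type*} [Fintype ι] [DecidableEq ι] {R : ι → Type*} [∀ i, CommRing (R i)]

lemma sum_units_pi_prod [∀ i, Fintype (R i)ˣ] [Fintype (∀ i, R i)ˣ] (ψ : ∀ i, AddChar (R i) ℂ) :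
    ∑ u : (∀ i, R i)ˣ, ∏ i, ψ i ((u : ∀ i, R i) i) = ∏ i, ∑ u : (R i)ˣ, ψ i u := by
  classical
  rw [Finset.prod_univ_sum, Fintype.piFinset_univ,
    ← Equiv.sum_comp (MulEquiv.piUnits (M := R)).toEquiv]
  rfl

/-- The character of a product with given components. -/
noncomputable def AddChar.piProd (ψ : ∀ i, AddChar (R i) ℂ) : AddChar (∀ i, R i) ℂ where
  toFun x := ∏ i, ψ i (x i)
  map_zero_eq_one' := by simp
  map_add_eq_mul' x y := by simp [AddChar.map_add_eq_mul, Finset.prod_mul_distrib]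

lemma AddChar.eq_piProd (ψ : AddChar (∀ i, R i) ℂ) :
    ψ = AddChar.piProd fun i => ψ.compAddMonoidHom (AddMonoidHom.single R i) := by
  ext x
  have h : ∀ s : Finset ι, ψ (∑ i ∈ s, Pi.single i (x i)) = ∏ i ∈ s, ψ (Pi.single i (x i)) := by
    intro s
    induction s using Finset.induction_on with
    | empty => simp
    | insert a s ha ih => rw [Finset.sum_insert ha, Finset.prod_insert ha, AddChar.map_add_eq_mul, ih]
  conv_lhs => rw [← Finset.univ_sum_single x, h]
  rfl

end Product

/-! ### The arithmetic criterion -/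

/-- The arithmetic form of the Ramanujan condition, for local factors with maximal ideals of order
`m i` and residue fields of order `w i + 1`. The degree is `r = ∏ m i * ∏ w i`, the nonzero
eigenvalue of largest absolute value below `r`, if there is one, is some `-r / w i` with `w i ≥ 2`,
and the inequality is the square of `r / w i ≤ 2 √(r - 1)`. -/
def RamanujanCriterion {ι : Type*} [Fintype ι] [DecidableEq ι] (m w : ι → ℕ) : Prop :=
  ∀ i, 2 ≤ w i →
    ((∏ j, m j) * ∏ j ∈ Finset.univ.erase i, w j) ^ 2 + 4 ≤ 4 * ((∏ j, m j) * ∏ j, w j)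

section Criterion

variable {ι : Type*} [Fintype ι] [DecidableEq ι] {R : ι → Type*} [∀ i, CommRing (R i)]
  [∀ i, IsLocalRing (R i)] [∀ i, Fintype (R i)]

lemma card_units_pi_eq [Fintype (∀ i, R i)ˣ] : Fintype.card (∀ i, R i)ˣ =
    (∏ i, maxIdealCard (R i)) * ∏ i, (Nat.card (IsLocalRing.ResidueField (R i)) - 1) := by
  classical
  rw [Fintype.card_congr (MulEquiv.piUnits (M := R)).toEquiv, Fintype.card_pi,
    ← Finset.prod_mul_distrib]
  exact Finset.prod_congr rfl fun i _ => card_units_eq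

open Classical in
/-- A character that is trivial on all factors other than `R i` and nontrivial on the residue field
of `R i` has the sum `-r / (q i - 1)` over the units. -/
lemma exists_sum_units_pi_eq_neg (i : ι) [Fintype (∀ i, R i)ˣ] :
    ∃ ψ : AddChar (∀ i, R i) ℂ, ∑ u : (∀ i, R i)ˣ, ψ u =
      -(((∏ j, maxIdealCard (R j)) *
        ∏ j ∈ Finset.univ.erase i, (Nat.card (IsLocalRing.ResidueField (R j)) - 1) : ℕ) : ℂ) := by
  obtain ⟨χ, hχ⟩ := exists_sum_units_eq_neg (A := R i)
  let φ : ∀ j, AddChar (R j) ℂ := Function.update (fun _ => 0) i χ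
  refine ⟨AddChar.piProd φ, ?_⟩
  have h := sum_units_pi_prod φ
  have h0 : ∀ j ∈ Finset.univ.erase i, ∑ u : (R j)ˣ, φ j u =
      ((maxIdealCard (R j) * (Nat.card (IsLocalRing.ResidueField (R j)) - 1) : ℕ) : ℂ) := by
    intro j hj
    have : φ j = 0 := Function.update_of_ne (Finset.ne_of_mem_erase hj) _ _
    rw [this, sum_units_zero]
    have h2 := two_le_card_residueField (A := R j)
    push_cast [Nat.cast_sub (show 1 ≤ Nat.card (IsLocalRing.ResidueField (R j)) by omega)]
    rfl
  refine Eq.trans h ?_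
  rw [← Finset.mul_prod_erase _ _ (Finset.mem_univ i), Finset.prod_congr rfl h0,
    ← Finset.mul_prod_erase _ (fun j => maxIdealCard (R j)) (Finset.mem_univ i)]
  have hi : φ i = χ := Function.update_self _ _ _
  rw [hi, hχ]
  push_cast [Finset.prod_mul_distrib]
  ring

open Classical in
lemma exists_real_prod_sum_units (ψ : AddChar (∀ i, R i) ℂ) [Fintype (∀ i, R i)ˣ] :
    ∃ d : ι → ℝ, ∑ u : (∀ i, R i)ˣ, ψ u = ((∏ i, d i : ℝ) : ℂ) ∧ ∀ i,
      |d i| = maxIdealCard (R i) * (Nat.card (IsLocalRing.ResidueField (R i)) - 1 : ℕ) ∨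
      |d i| = maxIdealCard (R i) ∨ d i = 0 := by
  have key : ∀ i, ∀ χ : AddChar (R i) ℂ, ∃ d : ℝ, ∑ u : (R i)ˣ, χ u = (d : ℂ) ∧
      (|d| = maxIdealCard (R i) * (Nat.card (IsLocalRing.ResidueField (R i)) - 1 : ℕ) ∨
      |d| = maxIdealCard (R i) ∨ d = 0) := by
    intro i χ
    rcases sum_units_addChar_cases χ with h | h | h
    · refine ⟨maxIdealCard (R i) * (Nat.card (IsLocalRing.ResidueField (R i)) - 1 : ℕ), ?_,
        Or.inl (abs_of_nonneg (by positivity))⟩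
      have h2 := two_le_card_residueField (A := R i)
      rw [h]
      push_cast [Nat.cast_sub (show 1 ≤ Nat.card (IsLocalRing.ResidueField (R i)) by omega)]
      rfl
    · exact ⟨-(maxIdealCard (R i)), by rw [h]; push_cast; rfl, Or.inr (Or.inl (by simp))⟩
    · exact ⟨0, by rw [h]; simp, Or.inr (Or.inr rfl)⟩
  choose d hd hd' using fun i => key i (ψ.compAddMonoidHom (AddMonoidHom.single R i))
  refine ⟨d, ?_, hd'⟩
  have h := sum_units_pi_prod fun i => ψ.compAddMonoidHom (AddMonoidHom.single R i)
  rw [Complex.ofReal_prod, ← Finset.prod_congr rfl fun i _ => hd i, ← h]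
  conv_lhs => rw [AddChar.eq_piProd ψ]
  rfl

/-- A nonzero eigenvalue is a product of local terms `m j * w j` and `-m j`; either some `-m i`
with `w i ≥ 2` occurs, or the absolute value is the degree. -/
lemma abs_prod_le_or_eq {m w : ι → ℕ} {d : ι → ℝ} (hw : ∀ i, 1 ≤ w i)
    (hd : ∀ i, |d i| = m i * w i ∨ |d i| = m i ∨ d i = 0) :
    ∏ i, d i = 0 ∨ |∏ i, d i| = ((∏ i, m i) * ∏ i, w i : ℕ) ∨
      ∃ i, 2 ≤ w i ∧ |∏ i, d i| ≤ ((∏ j, m j) * ∏ j ∈ Finset.univ.erase i, w j : ℕ) := by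
  by_cases h0 : ∃ i, d i = 0
  · obtain ⟨i, hi⟩ := h0
    exact Or.inl (Finset.prod_eq_zero (Finset.mem_univ i) hi)
  by_cases h1 : ∃ i, 2 ≤ w i ∧ |d i| = m i
  · obtain ⟨i, hi, hdi⟩ := h1
    refine Or.inr (Or.inr ⟨i, hi, ?_⟩)
    rw [Finset.abs_prod, ← Finset.mul_prod_erase _ _ (Finset.mem_univ i),
      ← Finset.mul_prod_erase _ m (Finset.mem_univ i), hdi]
    push_cast
    rw [mul_assoc, ← Finset.prod_mul_distrib]
    gcongr with j
    have hj : (1 : ℝ) ≤ w j := by exact_mod_cast hw j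
    rcases hd j with h | h | h
    · exact h.le
    · rw [h]
      exact le_mul_of_one_le_right (Nat.cast_nonneg _) hj
    · rw [h, abs_zero]
      positivity
  · push Not at h0 h1
    refine Or.inr (Or.inl ?_)
    rw [Finset.abs_prod, ← Finset.prod_mul_distrib, Nat.cast_prod]
    refine Finset.prod_congr rfl fun i _ => ?_
    rcases hd i with h | h | h
    · rw [h]; push_cast; rfl
    · have : w i = 1 := by
        by_contra hne
        exact h1 i (by have := hw i; omega) h
      rw [h, this, mul_one]
    · exact absurd h (h0 i)

theorem isRamanujanGraph_unitaryCayleyGraph_pi_iff [Nonempty ι] [Fintype (∀ i, R i)] :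
    IsRamanujanGraph (unitaryCayleyGraph (∀ i, R i)) ↔
      RamanujanCriterion (fun i => maxIdealCard (R i))
        (fun i => Nat.card (IsLocalRing.ResidueField (R i)) - 1) := by
  classical
  have : Nontrivial (∀ i, R i) :=
    ⟨⟨0, 1, fun h => zero_ne_one (congrFun h (Classical.arbitrary ι))⟩⟩
  set m : ι → ℕ := fun i => maxIdealCard (R i) with hm
  set w : ι → ℕ := fun i => Nat.card (IsLocalRing.ResidueField (R i)) - 1 with hw
  have hm1 : ∀ i, 1 ≤ m i := fun i => maxIdealCard_pos
  have hw1 : ∀ i, 1 ≤ w i := fun i => by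
    have := two_le_card_residueField (A := R i)
    simp only [hw]
    omega
  have hcard : Fintype.card (∀ i, R i)ˣ = (∏ i, m i) * ∏ i, w i := card_units_pi_eq
  have hT1 : ∀ i, 1 ≤ (∏ j, m j) * ∏ j ∈ Finset.univ.erase i, w j := fun i =>
    Nat.mul_pos (Finset.prod_pos fun j _ => hm1 j) (Finset.prod_pos fun j _ => hw1 j)
  have hT : ∀ i, ((∏ j, m j) * ∏ j ∈ Finset.univ.erase i, w j) * w i
      = (∏ j, m j) * ∏ j, w j := fun i => by
    rw [mul_assoc, Finset.prod_erase_mul _ _ (Finset.mem_univ i)]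
  have hr1 : 1 ≤ (∏ j, m j) * ∏ j, w j :=
    Nat.mul_pos (Finset.prod_pos fun j _ => hm1 j) (Finset.prod_pos fun j _ => hw1 j)
  constructor
  · rintro ⟨r, hr, hev⟩ i hi
    have hr' : r = (∏ j, m j) * ∏ j, w j := by
      rw [← hcard]
      refine (?_ : r = _)
      rw [← hr 0, ← isRegularOfDegree_unitaryCayleyGraph (A := ∀ i, R i) 0]
    obtain ⟨ψ, hψ⟩ := exists_sum_units_pi_eq_neg (R := R) i
    set t : ℕ := (∏ j, m j) * ∏ j ∈ Finset.univ.erase i, w j with ht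
    have hlt : t < r := by
      have h1 := hT1 i
      have h2 := hT i
      rw [hr', ← h2]
      nlinarith
    have hltR : (t : ℝ) < r := by exact_mod_cast hlt
    have htp : (0 : ℝ) < t := by exact_mod_cast hT1 i
    have h := hev (-(t : ℝ)) ?_ (by linarith) (by linarith)
    · rw [abs_neg, Nat.abs_cast] at h
      have hr0 : (0 : ℝ) ≤ (r : ℝ) - 1 := by
        rw [hr']
        have : (1 : ℝ) ≤ ((∏ j, m j) * ∏ j, w j : ℕ) := by exact_mod_cast hr1
        linarith
      have h2 : (t : ℝ) ^ 2 ≤ 4 * ((r : ℝ) - 1) := by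
        have := pow_le_pow_left₀ htp.le h 2
        rw [mul_pow, Real.sq_sqrt hr0] at this
        linarith
      have h3 : (t : ℝ) ^ 2 + 4 ≤ 4 * r := by linarith
      rw [← hr']
      exact_mod_cast h3
    · rw [hasEigenvalue_unitaryCayleyGraph_iff]
      refine ⟨ψ, ?_⟩
      rw [hψ]
      push_cast
      rfl
  · intro hcrit
    refine ⟨(∏ j, m j) * ∏ j, w j, ?_, ?_⟩
    · rw [← hcard]
      intro a
      rw [← isRegularOfDegree_unitaryCayleyGraph (A := ∀ i, R i) a]
    · intro μ hμ h1 h2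
      rw [hasEigenvalue_unitaryCayleyGraph_iff] at hμ
      obtain ⟨ψ, hψ⟩ := hμ
      obtain ⟨d, hd, hd'⟩ := exists_real_prod_sum_units ψ
      rw [hd, Complex.ofReal_inj] at hψ
      rw [← hψ] at h1 h2 ⊢
      rcases abs_prod_le_or_eq (m := m) (w := w) hw1 hd' with h | h | ⟨i, hi, h⟩
      · rw [h, abs_zero]
        positivity
      · rcases (abs_eq (Nat.cast_nonneg _)).1 h with h | h
        · exact absurd h h1
        · exact absurd h h2
      · refine h.trans ?_
        have := hcrit i hi
        set t : ℕ := (∏ j, m j) * ∏ j ∈ Finset.univ.erase i, w j with ht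
        set r : ℕ := (∏ j, m j) * ∏ j, w j with hr
        have h3 : (t : ℝ) ^ 2 + 4 ≤ 4 * r := by exact_mod_cast this
        have h4 : (t : ℝ) / 2 ≤ Real.sqrt ((r : ℝ) - 1) := by
          apply Real.le_sqrt_of_sq_le
          linarith
        linarith

end Criterion

/-! ### Finite local rings with a small maximal ideal -/

section SmallLocalRings

lemma exists_isoFiniteField_card (K : Type*) [Field K] [Finite K] :
    IsoFiniteField K (Nat.card K) := by
  have : Fintype K := Fintype.ofFinite K
  obtain ⟨p, hp, n, hpp, hn⟩ := FiniteField.card' K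
  have : Fact p.Prime := ⟨hpp⟩
  have : Algebra (ZMod p) K := ZMod.algebra K p
  refine ⟨p, n, ⟨hpp⟩, n.ne_zero, by rw [Nat.card_eq_fintype_card, hn], ?_⟩
  exact ⟨(GaloisField.algEquivGaloisField p n (by rw [Nat.card_eq_fintype_card, hn])).toRingEquiv⟩

lemma IsoFiniteField.natCard_eq {A : Type*} [CommRing A] {q : ℕ} (h : IsoFiniteField A q) :
    Nat.card A = q := by
  obtain ⟨p, n, hp, hn, rfl, ⟨e⟩⟩ := h
  rw [Nat.card_congr e.toEquiv, GaloisField.card p n hn]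

lemma IsoFiniteField.isField {A : Type*} [CommRing A] {q : ℕ} (h : IsoFiniteField A q) :
    IsField A := by
  obtain ⟨p, n, hp, -, -, ⟨e⟩⟩ := h
  exact e.toMulEquiv.isField (Field.toIsField _)

variable {A : Type*} [CommRing A] [IsLocalRing A]

lemma maxIdealCard_eq_one_iff : maxIdealCard A = 1 ↔ IsField A := by
  rw [IsLocalRing.isField_iff_maximalIdeal_eq, maxIdealCard, Nat.card_eq_one_iff_unique,
    ← Submodule.subsingleton_iff_eq_bot]
  exact ⟨fun h => h.1, fun h => ⟨h, ⟨0⟩⟩⟩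

lemma isoFiniteField_of_maxIdealCard_eq_one [Finite A] (h : maxIdealCard A = 1) :
    IsoFiniteField A (Nat.card (IsLocalRing.ResidueField A)) := by
  have hc := card_eq_maxIdealCard_mul (A := A)
  rw [h, one_mul] at hc
  rw [← hc]
  let := (maxIdealCard_eq_one_iff.1 h).toField
  exact exists_isoFiniteField_card A

lemma maxIdealCard_and_card_residueField_of_isoFiniteField {q : ℕ} (h : IsoFiniteField A q) :
    maxIdealCard A = 1 ∧ Nat.card (IsLocalRing.ResidueField A) = q := by
  have h1 := maxIdealCard_eq_one_iff.2 h.isField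
  refine ⟨h1, ?_⟩
  rw [← h.natCard_eq, card_eq_maxIdealCard_mul (A := A), h1, one_mul]

/-- A nonzero maximal ideal `M` has a nonzero cotangent space by Nakayama, so the order of the
residue field divides the order of `M / M ^ 2`. -/
lemma card_residueField_dvd_card_cotangentSpace [Finite A] (h : maxIdealCard A ≠ 1) :
    Nat.card (IsLocalRing.ResidueField A) ∣ Nat.card (IsLocalRing.CotangentSpace A) := by
  have hf : Module.finrank (IsLocalRing.ResidueField A) (IsLocalRing.CotangentSpace A) ≠ 0 := by
    rw [Ne, IsLocalRing.finrank_cotangentSpace_eq_zero_iff, ← maxIdealCard_eq_one_iff]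
    exact h
  rw [Module.natCard_eq_pow_finrank (K := IsLocalRing.ResidueField A)
    (V := IsLocalRing.CotangentSpace A)]
  exact dvd_pow_self _ hf

lemma maxIdealCard_eq_mul_card_cotangentSpace : maxIdealCard A =
    Nat.card (IsLocalRing.maximalIdeal A •
      (⊤ : Submodule A (IsLocalRing.maximalIdeal A)) : Submodule A (IsLocalRing.maximalIdeal A)) *
      Nat.card (IsLocalRing.CotangentSpace A) :=
  Submodule.card_eq_card_quotient_mul_card _

lemma card_residueField_dvd_maxIdealCard [Finite A] (h : maxIdealCard A ≠ 1) :
    Nat.card (IsLocalRing.ResidueField A) ∣ maxIdealCard A :=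
  (card_residueField_dvd_card_cotangentSpace h).trans
    (maxIdealCard_eq_mul_card_cotangentSpace (A := A) ▸ dvd_mul_left _ _)

lemma mul_eq_zero_of_mem_maximalIdeal [Finite A]
    (h : maxIdealCard A = Nat.card (IsLocalRing.ResidueField A)) {x y : A}
    (hx : x ∈ IsLocalRing.maximalIdeal A) (hy : y ∈ IsLocalRing.maximalIdeal A) : x * y = 0 := by
  have hq := two_le_card_residueField (A := A)
  have hdvd := card_residueField_dvd_card_cotangentSpace (A := A) (by omega)
  have hmul := maxIdealCard_eq_mul_card_cotangentSpace (A := A)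
  set k := Nat.card (IsLocalRing.maximalIdeal A •
      (⊤ : Submodule A (IsLocalRing.maximalIdeal A)) : Submodule A (IsLocalRing.maximalIdeal A))
    with hk
  obtain ⟨c, hc⟩ := hdvd
  have hk1 : k = 1 := by
    rw [hc, h] at hmul
    have h1 : Nat.card (IsLocalRing.ResidueField A) * (k * c)
        = Nat.card (IsLocalRing.ResidueField A) * 1 := by linarith
    exact Nat.eq_one_of_mul_eq_one_right (Nat.eq_of_mul_eq_mul_left (by omega) h1)
  rw [hk, Nat.card_eq_one_iff_unique] at hk1
  have hbot := (Submodule.subsingleton_iff_eq_bot).1 hk1.1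
  have hmem : x • (⟨y, hy⟩ : IsLocalRing.maximalIdeal A) ∈ IsLocalRing.maximalIdeal A •
      (⊤ : Submodule A (IsLocalRing.maximalIdeal A)) :=
    Submodule.smul_mem_smul hx Submodule.mem_top
  rw [hbot, Submodule.mem_bot] at hmem
  exact congrArg Subtype.val hmem

section Classification

variable {p : ℕ} [hp : Fact p.Prime]

lemma eq_zero_of_algebraMap_mem_maximalIdeal [Algebra (ZMod p) A] {a : ZMod p}
    (ha : algebraMap (ZMod p) A a ∈ IsLocalRing.maximalIdeal A) : a = 0 := by
  by_contra hne
  exact ha ((IsUnit.mk0 a hne).map (algebraMap (ZMod p) A))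

/-- For `x` in the maximal ideal with `x ≠ 0` and `x ^ 2 = 0`, evaluation at `x` has kernel
`(X ^ 2)`. -/
lemma X_sq_dvd_of_aeval_eq_zero [Algebra (ZMod p) A] {x : A}
    (hx : x ∈ IsLocalRing.maximalIdeal A) (hx0 : x ≠ 0) (hxx : x * x = 0) {g : (ZMod p)[X]}
    (hg : aeval x g = 0) : X ^ 2 ∣ g := by
  have h1 := divX_mul_X_add g
  have h2 := divX_mul_X_add (divX g)
  rw [← h1, ← h2] at hg
  simp only [map_add, map_mul, aeval_X, aeval_C] at hg
  set a := g.coeff 0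
  set b := (divX g).coeff 0
  have hg' : algebraMap (ZMod p) A b * x + algebraMap (ZMod p) A a = 0 := by
    linear_combination hg - (aeval x g.divX.divX) * hxx
  have ha : a = 0 := by
    apply eq_zero_of_algebraMap_mem_maximalIdeal (A := A)
    rw [eq_neg_of_add_eq_zero_right hg']
    exact neg_mem (Ideal.mul_mem_left _ _ hx)
  have hb : b = 0 := by
    by_contra hne
    rw [ha, map_zero, add_zero] at hg'
    exact hx0 (((IsUnit.mk0 b hne).map (algebraMap (ZMod p) A)).mul_right_eq_zero.1 hg')
  refine ⟨divX (divX g), ?_⟩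
  conv_lhs => rw [← h1, ← h2]
  rw [ha, hb, map_zero]
  ring

lemma card_zmod_polynomial_quotient_X_sq :
    Nat.card ((ZMod p)[X] ⧸ Ideal.span {(X : (ZMod p)[X]) ^ 2}) = p ^ 2 := by
  have hX : ((X : (ZMod p)[X]) ^ 2) ≠ 0 := pow_ne_zero _ X_ne_zero
  have hfr := finrank_quotient_span_eq_natDegree (f := (X : (ZMod p)[X]) ^ 2)
  rw [natDegree_X_pow] at hfr
  have : Module.Finite (ZMod p) ((ZMod p)[X] ⧸ Ideal.span {(X : (ZMod p)[X]) ^ 2}) :=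
    Module.finite_of_finrank_pos (by omega)
  rw [Module.natCard_eq_pow_finrank (K := ZMod p), hfr, Nat.card_zmod]

/-- A finite local ring with maximal ideal and residue field of the same prime order `p` is
`ℤ / p ^ 2` or `𝔽_p[X] / (X ^ 2)`, according to whether `p` is nonzero in it. -/
lemma ringEquiv_of_maxIdealCard_eq_prime [Finite A] (hm : maxIdealCard A = p)
    (hq : Nat.card (IsLocalRing.ResidueField A) = p) :
    Nonempty (A ≃+* ZMod (p ^ 2)) ∨
      Nonempty (A ≃+* (ZMod p)[X] ⧸ Ideal.span {(X : (ZMod p)[X]) ^ 2}) := by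
  have : Fintype A := Fintype.ofFinite A
  have hcard : Nat.card A = p ^ 2 := by rw [card_eq_maxIdealCard_mul, hm, hq, sq]
  have hpM : (p : A) ∈ IsLocalRing.maximalIdeal A := by
    rw [← IsLocalRing.residue_eq_zero_iff, map_natCast, ← hq]
    have : Fintype (IsLocalRing.ResidueField A) := Fintype.ofFinite _
    rw [Nat.card_eq_fintype_card]
    exact Nat.cast_card_eq_zero _
  have hsq : ∀ x ∈ IsLocalRing.maximalIdeal A, x * x = 0 := fun x hx =>
    mul_eq_zero_of_mem_maximalIdeal (hm.trans hq.symm) hx hx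
  by_cases hp0 : (p : A) = 0
  · right
    have : CharP A p := (CharP.charP_iff_prime_eq_zero hp.out).2 hp0
    let := ZMod.algebra A p
    obtain ⟨x, hx, hx0⟩ : ∃ x ∈ IsLocalRing.maximalIdeal A, x ≠ 0 := by
      apply Submodule.exists_mem_ne_zero_of_ne_bot
      rw [Ne, ← IsLocalRing.isField_iff_maximalIdeal_eq, ← maxIdealCard_eq_one_iff, hm]
      exact hp.out.ne_one
    have hX : ∀ g ∈ Ideal.span {(X : (ZMod p)[X]) ^ 2}, aeval x g = 0 := by
      intro g hg
      obtain ⟨k, rfl⟩ := Ideal.mem_span_singleton.1 hg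
      simp [sq, hsq x hx]
    let φ := Ideal.Quotient.lift (Ideal.span {(X : (ZMod p)[X]) ^ 2})
      (aeval x : (ZMod p)[X] →ₐ[ZMod p] A).toRingHom hX
    have hinj : Function.Injective φ := by
      rw [injective_iff_map_eq_zero]
      intro y hy
      obtain ⟨g, rfl⟩ := Ideal.Quotient.mk_surjective y
      rw [Ideal.Quotient.eq_zero_iff_mem, Ideal.mem_span_singleton]
      exact X_sq_dvd_of_aeval_eq_zero hx hx0 (hsq x hx) hy
    have hbij : Function.Bijective φ := by
      rw [Nat.bijective_iff_injective_and_card]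
      exact ⟨hinj, by rw [card_zmod_polynomial_quotient_X_sq, hcard]⟩
    exact ⟨(RingEquiv.ofBijective φ hbij).symm⟩
  · left
    have hchar : ringChar A = p ^ 2 := by
      have hdvd : ringChar A ∣ p ^ 2 := by
        apply ringChar.dvd
        push_cast
        rw [sq]
        exact hsq _ hpM
      obtain ⟨k, hk, hk'⟩ := (Nat.dvd_prime_pow hp.out).1 hdvd
      have hk2 : ¬ k ≤ 1 := by
        intro hk1
        apply hp0
        rw [ringChar.spec, hk']
        exact (pow_dvd_pow p hk1).trans (by rw [pow_one])
      rw [hk', show k = 2 by omega]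
    have : CharP A (p ^ 2) := ringChar.of_eq hchar
    exact ⟨(ZMod.ringEquiv A (by rw [← Nat.card_eq_fintype_card, hcard])).symm⟩

/-- The order of the residue field divides that of a nonzero maximal ideal, so its square
divides `p ^ 2`. -/
lemma maxIdealCard_eq_of_card_eq_sq [Finite A] (hcard : Nat.card A = p ^ 2) (hA : ¬ IsField A) :
    maxIdealCard A = p ∧ Nat.card (IsLocalRing.ResidueField A) = p := by
  rw [← maxIdealCard_eq_one_iff] at hA
  have hdvd := card_residueField_dvd_maxIdealCard hA
  rw [card_eq_maxIdealCard_mul] at hcard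
  have hq := two_le_card_residueField (A := A)
  have h1 : Nat.card (IsLocalRing.ResidueField A) ^ 2 ∣ p ^ 2 := by
    rw [← hcard, sq]
    exact mul_dvd_mul_right hdvd _
  have h2 : Nat.card (IsLocalRing.ResidueField A) = p :=
    ((Nat.dvd_prime hp.out).1 ((Nat.pow_dvd_pow_iff two_ne_zero).1 h1)).resolve_left (by omega)
  refine ⟨?_, h2⟩
  rw [h2, sq] at hcard
  exact Nat.eq_of_mul_eq_mul_right hp.out.pos hcard

lemma maxIdealCard_eq_of_ringEquiv [Finite A] (h : Nonempty (A ≃+* ZMod (p ^ 2)) ∨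
      Nonempty (A ≃+* (ZMod p)[X] ⧸ Ideal.span {(X : (ZMod p)[X]) ^ 2})) :
    maxIdealCard A = p ∧ Nat.card (IsLocalRing.ResidueField A) = p := by
  rcases h with ⟨⟨e⟩⟩ | ⟨⟨e⟩⟩
  · apply maxIdealCard_eq_of_card_eq_sq
    · rw [Nat.card_congr e.toEquiv, Nat.card_zmod]
    · intro hA
      let := (e.symm.toMulEquiv.isField hA).toField
      have hmul : ((p : ℕ) : ZMod (p ^ 2)) ^ 2 = 0 := by
        rw [← Nat.cast_pow, ZMod.natCast_self]
      have h0 : ((p : ℕ) : ZMod (p ^ 2)) = 0 := pow_eq_zero_iff two_ne_zero |>.1 hmul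
      rw [ZMod.natCast_eq_zero_iff] at h0
      have := Nat.le_of_dvd hp.out.pos h0
      have := hp.out.two_le
      nlinarith
  · apply maxIdealCard_eq_of_card_eq_sq
    · rw [Nat.card_congr e.toEquiv, card_zmod_polynomial_quotient_X_sq]
    · intro hA
      let := (e.symm.toMulEquiv.isField hA).toField
      have hmul : (Ideal.Quotient.mk (Ideal.span {(X : (ZMod p)[X]) ^ 2}) X) ^ 2 = 0 := by
        rw [← map_pow, Ideal.Quotient.eq_zero_iff_mem]
        exact Ideal.mem_span_singleton_self _
      have h0 := pow_eq_zero_iff two_ne_zero |>.1 hmul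
      rw [Ideal.Quotient.eq_zero_iff_mem, Ideal.mem_span_singleton, X_pow_dvd_iff] at h0
      simpa using h0 1 one_lt_two

end Classification

end SmallLocalRings

/-! ### Evaluating the arithmetic criterion -/

section Arithmetic

variable {ι : Type*} [Fintype ι] [DecidableEq ι] {m w : ι → ℕ}

lemma ramanujanCriterion_comp_perm (σ : Equiv.Perm ι) (h : RamanujanCriterion (m ∘ σ) (w ∘ σ)) :
    RamanujanCriterion m w := by
  intro i hi
  have h1 := h (σ.symm i) (by simpa using hi)
  have h2 : ∏ j ∈ Finset.univ.erase (σ.symm i), w (σ j) = ∏ j ∈ Finset.univ.erase i, w j :=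
    Finset.prod_equiv σ (by simp [Equiv.eq_symm_apply]) (by simp)
  simpa [h2, Equiv.prod_comp σ m, Equiv.prod_comp σ w] using h1

/-- Only the smallest `w a ≥ 2` matters, as it gives the largest value of `r / w i`. -/
lemma ramanujanCriterion_iff_of_min {a : ι} (ha : 2 ≤ w a) (hmin : ∀ i, 2 ≤ w i → w a ≤ w i) :
    RamanujanCriterion m w ↔ ((∏ j, m j) * ∏ j ∈ Finset.univ.erase a, w j) ^ 2 + 4 ≤
      4 * ((∏ j, m j) * (w a * ∏ j ∈ Finset.univ.erase a, w j)) := by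
  rw [Finset.mul_prod_erase _ _ (Finset.mem_univ a)]
  refine ⟨fun h => h a ha, fun h i hi => ?_⟩
  refine le_trans ?_ h
  gcongr ?_ ^ 2 + 4
  refine Nat.mul_le_mul_left _ ?_
  have h1 := Finset.mul_prod_erase Finset.univ w (Finset.mem_univ a)
  have h2 := Finset.mul_prod_erase Finset.univ w (Finset.mem_univ i)
  refine Nat.le_of_mul_le_mul_left ?_ (by omega : 0 < w i)
  rw [h2, ← h1]
  exact Nat.mul_le_mul_right _ (hmin i hi)

lemma ramanujanCriterion_iff_of_one {a : ι} (ha : 2 ≤ w a) (hw : ∀ i, i ≠ a → w i = 1) :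
    RamanujanCriterion m w ↔ (∏ j, m j) ^ 2 + 4 ≤ 4 * ((∏ j, m j) * w a) := by
  have hp : ∏ j ∈ Finset.univ.erase a, w j = 1 :=
    Finset.prod_eq_one fun j hj => hw j (Finset.ne_of_mem_erase hj)
  rw [ramanujanCriterion_iff_of_min ha, hp, mul_one, mul_one]
  intro i hi
  by_cases h : i = a
  · rw [h]
  · have := hw i h
    omega

lemma ramanujanCriterion_iff_of_two {a b : ι} (hab : a ≠ b) (ha : 2 ≤ w a) (hb : w a ≤ w b)
    (hw : ∀ i, i ≠ a → i ≠ b → w i = 1) :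
    RamanujanCriterion m w ↔
      ((∏ j, m j) * w b) ^ 2 + 4 ≤ 4 * ((∏ j, m j) * (w a * w b)) := by
  have hp : ∏ j ∈ Finset.univ.erase a, w j = w b := by
    apply Finset.prod_eq_single_of_mem b (by simp [hab.symm])
    exact fun j hj hjb => hw j (Finset.ne_of_mem_erase hj) hjb
  rw [ramanujanCriterion_iff_of_min ha, hp]
  intro i hi
  by_cases h : i = a
  · rw [h]
  by_cases h' : i = b
  · rw [h']
    exact hb
  · have := hw i h h'
    omega

lemma ramanujanCriterion_iff_of_three {a b c : ι} (hab : a ≠ b) (hac : a ≠ c) (hbc : b ≠ c)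
    (ha : 2 ≤ w a) (hb : w a ≤ w b) (hc : w a ≤ w c)
    (hw : ∀ i, i ≠ a → i ≠ b → i ≠ c → w i = 1) :
    RamanujanCriterion m w ↔
      ((∏ j, m j) * (w b * w c)) ^ 2 + 4 ≤ 4 * ((∏ j, m j) * (w a * (w b * w c))) := by
  have hp : ∏ j ∈ Finset.univ.erase a, w j = w b * w c := by
    rw [← Finset.prod_pair hbc]
    symm
    apply Finset.prod_subset
    · intro x hx
      simp only [Finset.mem_insert, Finset.mem_singleton] at hx
      rcases hx with rfl | rfl
      · simp [hab.symm]
      · simp [hac.symm]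
    · intro j hj hj'
      simp only [Finset.mem_insert, Finset.mem_singleton, not_or] at hj'
      exact hw j (Finset.ne_of_mem_erase hj) hj'.1 hj'.2
  rw [ramanujanCriterion_iff_of_min ha, hp]
  intro i hi
  by_cases h : i = a
  · rw [h]
  by_cases h' : i = b
  · rw [h']
    exact hb
  by_cases h'' : i = c
  · rw [h'']
    exact hc
  · have := hw i h h' h''
    omega

/-- With four residue fields of order at least `3` the value `r / w a` is at least `4 * w a`. -/
lemma not_ramanujanCriterion_of_four {a b c d : ι} (hab : a ≠ b) (hac : a ≠ c) (had : a ≠ d)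
    (hbc : b ≠ c) (hbd : b ≠ d) (hcd : c ≠ d) (hm : ∀ i, 1 ≤ m i) (hw : ∀ i, 1 ≤ w i)
    (ha : 2 ≤ w a) (hb : w a ≤ w b) (hc : w a ≤ w c) (hd : w a ≤ w d) :
    ¬ RamanujanCriterion m w := by
  intro h
  have h1 := h a ha
  rw [← Finset.mul_prod_erase Finset.univ w (Finset.mem_univ a)] at h1
  have h2 : w b * (w c * w d) ≤ ∏ j ∈ Finset.univ.erase a, w j := by
    have h3 : w b * (w c * w d) = ∏ j ∈ ({b, c, d} : Finset ι), w j := by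
      rw [Finset.prod_insert (by simp [hbc, hbd]), Finset.prod_pair hcd]
    rw [h3]
    apply Finset.prod_le_prod_of_subset_of_one_le'
    · intro x hx
      simp only [Finset.mem_insert, Finset.mem_singleton] at hx
      rcases hx with rfl | rfl | rfl
      · simp [hab.symm]
      · simp [hac.symm]
      · simp [had.symm]
    · exact fun i _ _ => hw i
  have hM : 1 ≤ ∏ j, m j := Finset.one_le_prod' fun j _ => hm j
  set M := ∏ j, m j
  set P := ∏ j ∈ Finset.univ.erase a, w j
  have h4 : 4 * w a ≤ M * P := by
    calc 4 * w a = w a * (2 * 2) := by ring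
      _ ≤ w b * (w c * w d) := by gcongr <;> omega
      _ ≤ 1 * P := by omega
      _ ≤ M * P := by gcongr
  have h5 : 4 * (M * (w a * P)) ≤ (M * P) ^ 2 := by
    calc 4 * (M * (w a * P)) = (4 * w a) * (M * P) := by ring
      _ ≤ (M * P) * (M * P) := by gcongr
      _ = (M * P) ^ 2 := by ring
  omega

lemma exists_eq_prime_of_prod_eq_prime {p : ℕ} (hp : p.Prime) (h : ∏ j, m j = p) :
    ∃ i, m i = p ∧ ∀ j, j ≠ i → m j = 1 := by
  have hdvd : ∀ i, m i = 1 ∨ m i = p := fun i =>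
    (Nat.dvd_prime hp).1 (h ▸ Finset.dvd_prod_of_mem m (Finset.mem_univ i))
  obtain ⟨i, hi⟩ : ∃ i, m i = p := by
    by_contra! hne
    exact hp.ne_one (h ▸ Finset.prod_eq_one fun i _ => (hdvd i).resolve_right (hne i))
  refine ⟨i, hi, fun j hj => ?_⟩
  rw [← Finset.mul_prod_erase _ _ (Finset.mem_univ i), hi] at h
  have h1 : ∏ k ∈ Finset.univ.erase i, m k = 1 :=
    Nat.eq_of_mul_eq_mul_left hp.pos (by rw [h, mul_one])
  exact Finset.prod_eq_one_iff.1 h1 j (by simp [hj])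

/-- The quadratic inequality in `t` solved for `t`; its smaller root is less than `1`. -/
lemma sq_add_four_le_iff {t q : ℕ} (ht : 1 ≤ t) (hq : 3 ≤ q) :
    t ^ 2 + 4 ≤ 4 * (t * (q - 1)) ↔
      (t : ℝ) ≤ 2 * ((q : ℝ) - 1 + Real.sqrt (((q : ℝ) - 2) * q)) := by
  have hqR : (3 : ℝ) ≤ q := by exact_mod_cast hq
  have htR : (1 : ℝ) ≤ t := by exact_mod_cast ht
  have hcast : t ^ 2 + 4 ≤ 4 * (t * (q - 1)) ↔ (t : ℝ) ^ 2 + 4 ≤ 4 * (t * ((q : ℝ) - 1)) := by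
    rw [← Nat.cast_le (α := ℝ)]
    push_cast [Nat.cast_sub (show 1 ≤ q by omega)]
    rfl
  rw [hcast]
  have hnn : 0 ≤ ((q : ℝ) - 2) * q := by nlinarith
  have hd0 := Real.sqrt_nonneg (((q : ℝ) - 2) * q)
  have hd2 := Real.sq_sqrt hnn
  set d := Real.sqrt (((q : ℝ) - 2) * q)
  constructor
  · intro h
    by_contra! hlt
    nlinarith
  · intro h
    have hd : (q : ℝ) - 3 / 2 ≤ d := by
      by_contra! hlt
      nlinarith
    have := sq_le_sq' (a := (t : ℝ) - 2 * (q - 1)) (b := 2 * d) (by linarith) (by linarith)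
    nlinarith

end Arithmetic

lemma apply_swap_eq_of_eq {ι : Type*} [DecidableEq ι] {q : ι → ℕ} {a b : ι} (h : q a = q b)
    (i : ι) : q (Equiv.swap a b i) = q i := by
  rw [Equiv.swap_apply_def]
  split_ifs with h1 h2
  · rw [h1, h]
  · rw [h2, h]
  · rfl

/-! ### Classification of the admissible orders -/

/-- Orders of maximal ideals `m` and residue fields `q` in the eight families. -/
def AdmissibleOrders {s : ℕ} (m q : Fin s → ℕ) : Prop :=
  (∀ i, q i = 2) ∨
  (3 ≤ s ∧ ∀ i : Fin s,
    ((i : ℕ) + 1 ≤ s - 3 → m i = 1 ∧ q i = 2) ∧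
    (s - 2 ≤ (i : ℕ) + 1 → m i = 1 ∧ q i = 3)) ∨
  (3 ≤ s ∧ ∀ i : Fin s,
    ((i : ℕ) + 1 ≤ s - 3 → m i = 1 ∧ q i = 2) ∧
    ((i : ℕ) + 1 = s - 2 ∨ (i : ℕ) + 1 = s - 1 → m i = 1 ∧ q i = 3) ∧
    ((i : ℕ) + 1 = s → m i = 1 ∧ q i = 4)) ∨
  (3 ≤ s ∧ ∀ i : Fin s,
    ((i : ℕ) + 1 ≤ s - 3 → m i = 1 ∧ q i = 2) ∧
    (s - 2 ≤ (i : ℕ) + 1 → m i = 1 ∧ q i = 4)) ∨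
  (∀ i : Fin s,
    ((i : ℕ) + 1 ≤ s - 2 → m i = 1 ∧ q i = 2) ∧
    ((i : ℕ) + 1 = s - 1 → m i = 1 ∧ q i = 3) ∧
    ((i : ℕ) + 1 = s → m i = 3 ∧ q i = 3)) ∨
  (3 ≤ s ∧ ∃ q₁ q₂ : ℕ, 3 ≤ q₁ ∧ 3 ≤ q₂ ∧
    q₁ ≤ q₂ ∧ (q₂ : ℝ) ≤ q₁ + Real.sqrt (((q₁ : ℝ) - 2) * q₁) ∧
    ∀ i : Fin s,
      ((i : ℕ) + 1 = 1 → m i = 2 ∧ q i = 2) ∧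
      (2 ≤ (i : ℕ) + 1 → (i : ℕ) + 1 ≤ s - 2 → m i = 1 ∧ q i = 2) ∧
      ((i : ℕ) + 1 = s - 1 → m i = 1 ∧ q i = q₁) ∧
      ((i : ℕ) + 1 = s → m i = 1 ∧ q i = q₂)) ∨
  (∃ q₁ q₂ : ℕ, 3 ≤ q₁ ∧ 3 ≤ q₂ ∧
    q₁ ≤ q₂ ∧ (q₂ : ℝ) ≤ 2 * (q₁ + Real.sqrt (((q₁ : ℝ) - 2) * q₁)) - 1 ∧
    ∀ i : Fin s,
      ((i : ℕ) + 1 ≤ s - 2 → m i = 1 ∧ q i = 2) ∧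
      ((i : ℕ) + 1 = s - 1 → m i = 1 ∧ q i = q₁) ∧
      ((i : ℕ) + 1 = s → m i = 1 ∧ q i = q₂)) ∨
  (∃ q' : ℕ, 3 ≤ q' ∧
    (∀ i : Fin s,
      ((i : ℕ) + 1 ≤ s - 1 → q i = 2) ∧
      ((i : ℕ) + 1 = s → q i = q')) ∧
    ((∏ i, m i : ℕ) : ℝ) ≤ 2 * ((q' : ℝ) - 1 + Real.sqrt (((q' : ℝ) - 2) * q')))

section Classification

variable {s : ℕ} {m q : Fin s → ℕ}

lemma ramanujanCriterion_of_three_fields (hs : 3 ≤ s) {x y z : ℕ} (hx : 3 ≤ x) (hxy : x ≤ y)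
    (hxz : x ≤ z) (hlow : ∀ i : Fin s, (i : ℕ) + 1 ≤ s - 3 → m i = 1 ∧ q i = 2)
    (h3 : m ⟨s - 3, by omega⟩ = 1 ∧ q ⟨s - 3, by omega⟩ = x)
    (h2 : m ⟨s - 2, by omega⟩ = 1 ∧ q ⟨s - 2, by omega⟩ = y)
    (h1 : m ⟨s - 1, by omega⟩ = 1 ∧ q ⟨s - 1, by omega⟩ = z)
    (hxyz : ((y - 1) * (z - 1)) ^ 2 + 4 ≤ 4 * ((x - 1) * ((y - 1) * (z - 1)))) :
    RamanujanCriterion m (fun i => q i - 1) := by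
  have hcases : ∀ i : Fin s, (i : ℕ) + 1 ≤ s - 3 ∨ i = ⟨s - 3, by omega⟩ ∨
      i = ⟨s - 2, by omega⟩ ∨ i = ⟨s - 1, by omega⟩ := by
    intro i
    simp only [Fin.ext_iff]
    omega
  have hm : ∏ i, m i = 1 := by
    refine Finset.prod_eq_one fun i _ => ?_
    rcases hcases i with h | rfl | rfl | rfl
    exacts [(hlow i h).1, h3.1, h2.1, h1.1]
  rw [ramanujanCriterion_iff_of_three (a := ⟨s - 3, by omega⟩) (b := ⟨s - 2, by omega⟩)
    (c := ⟨s - 1, by omega⟩) (by simp only [Ne, Fin.ext_iff]; omega)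
    (by simp only [Ne, Fin.ext_iff]; omega) (by simp only [Ne, Fin.ext_iff]; omega)
    (by simp only [h3.2]; omega) (by simp only [h3.2, h2.2]; omega)
    (by simp only [h3.2, h1.2]; omega), hm, h3.2, h2.2, h1.2, one_mul, one_mul]
  · exact hxyz
  · intro i hi3 hi2 hi1
    rcases hcases i with h | h | h | h
    · simp only [(hlow i h).2]
    · exact absurd h hi3
    · exact absurd h hi2
    · exact absurd h hi1

/-- The criterion with exactly two residue fields of order at least `3`, in the last two places. -/
lemma ramanujanCriterion_iff_of_last_two (hs : 2 ≤ s)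
    (hlow : ∀ i : Fin s, (i : ℕ) + 1 ≤ s - 2 → q i = 2)
    {x y : ℕ} (hx : 3 ≤ x) (hxy : x ≤ y) (h2 : q ⟨s - 2, by omega⟩ = x)
    (h1 : q ⟨s - 1, by omega⟩ = y) :
    RamanujanCriterion m (fun i => q i - 1) ↔
      ((∏ j, m j) * (y - 1)) ^ 2 + 4 ≤ 4 * ((∏ j, m j) * (y - 1) * (x - 1)) := by
  rw [ramanujanCriterion_iff_of_two (a := ⟨s - 2, by omega⟩) (b := ⟨s - 1, by omega⟩)
    (by simp only [Ne, Fin.ext_iff]; omega) (by simp only [h2]; omega)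
    (by simp only [h2, h1]; omega), h2, h1, mul_assoc, mul_comm (y - 1)]
  intro i hi2 hi1
  rw [Ne, Fin.ext_iff] at hi1 hi2
  simp only at hi1 hi2
  rw [hlow i (by omega)]

lemma AdmissibleOrders.ramanujanCriterion (hs : 2 ≤ s) (hm : ∀ i, 1 ≤ m i)
    (h : AdmissibleOrders m q) : RamanujanCriterion m (fun i => q i - 1) := by
  have hM : 1 ≤ ∏ i, m i := Finset.one_le_prod' fun i _ => hm i
  rcases h with h | ⟨hs3, h⟩ | ⟨hs3, h⟩ | ⟨hs3, h⟩ | h | ⟨hs3, q₁, q₂, hq₁, hq₂, hq, hle, h⟩ |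
    ⟨q₁, q₂, hq₁, hq₂, hq, hle, h⟩ | ⟨q', hq', h, hle⟩
  · intro i hi
    simp only [h i] at hi
    omega
  · exact ramanujanCriterion_of_three_fields hs3 (x := 3) (y := 3) (z := 3) le_rfl le_rfl le_rfl
      (fun i => (h i).1) ((h _).2 (by simp only; omega)) ((h _).2 (by simp only; omega))
      ((h _).2 (by simp only; omega)) (by norm_num)
  · exact ramanujanCriterion_of_three_fields hs3 (x := 3) (y := 3) (z := 4) le_rfl le_rfl
      (by norm_num) (fun i => (h i).1) ((h _).2.1 (by simp only; omega))
      ((h _).2.1 (by simp only; omega)) ((h _).2.2 (by simp only; omega)) (by norm_num)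
  · exact ramanujanCriterion_of_three_fields hs3 (x := 4) (y := 4) (z := 4) (by norm_num) le_rfl
      le_rfl (fun i => (h i).1) ((h _).2 (by simp only; omega)) ((h _).2 (by simp only; omega))
      ((h _).2 (by simp only; omega)) (by norm_num)
  · have h2 := (h ⟨s - 2, by omega⟩).2.1 (by simp only; omega)
    have h1 := (h ⟨s - 1, by omega⟩).2.2 (by simp only; omega)
    rw [ramanujanCriterion_iff_of_last_two hs (fun i hi => ((h i).1 hi).2) le_rfl le_rfl h2.2 h1.2,
      Fintype.prod_eq_single (f := m) ⟨s - 1, by omega⟩, h1.1]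
    · norm_num
    · intro i hi
      rw [Ne, Fin.ext_iff] at hi
      simp only at hi
      by_cases hi' : (i : ℕ) + 1 = s - 1
      · exact ((h i).2.1 hi').1
      · exact ((h i).1 (by omega)).1
  · have h2 := (h ⟨s - 2, by omega⟩).2.2.1 (by simp only; omega)
    have h1 := (h ⟨s - 1, by omega⟩).2.2.2 (by simp only; omega)
    have h0 := (h ⟨0, by omega⟩).1 (by simp)
    rw [ramanujanCriterion_iff_of_last_two hs _ hq₁ hq h2.2 h1.2,
      Fintype.prod_eq_single (f := m) ⟨0, by omega⟩, h0.1, sq_add_four_le_iff (by omega) hq₁]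
    · push_cast [Nat.cast_sub (show 1 ≤ q₂ by omega)]
      linarith
    · intro i hi
      rw [Ne, Fin.ext_iff] at hi
      simp only at hi
      by_cases hi1 : (i : ℕ) + 1 = s
      · exact ((h i).2.2.2 hi1).1
      by_cases hi2 : (i : ℕ) + 1 = s - 1
      · exact ((h i).2.2.1 hi2).1
      · exact ((h i).2.1 (by omega) (by omega)).1
    · intro i hi
      by_cases hi0 : (i : ℕ) + 1 = 1
      · exact ((h i).1 hi0).2
      · exact ((h i).2.1 (by omega) hi).2
  · have h2 := (h ⟨s - 2, by omega⟩).2.1 (by simp only; omega)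
    have h1 := (h ⟨s - 1, by omega⟩).2.2 (by simp only; omega)
    have hone : ∏ i, m i = 1 := by
      refine Finset.prod_eq_one fun i _ => ?_
      by_cases hi1 : (i : ℕ) + 1 = s
      · exact ((h i).2.2 hi1).1
      by_cases hi2 : (i : ℕ) + 1 = s - 1
      · exact ((h i).2.1 hi2).1
      · exact ((h i).1 (by omega)).1
    rw [ramanujanCriterion_iff_of_last_two hs (fun i hi => ((h i).1 hi).2) hq₁ hq h2.2 h1.2, hone,
      sq_add_four_le_iff (by omega) hq₁]
    push_cast [Nat.cast_sub (show 1 ≤ q₂ by omega)]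
    linarith
  · have h1 := (h ⟨s - 1, by omega⟩).2 (by simp only; omega)
    rw [ramanujanCriterion_iff_of_one (a := ⟨s - 1, by omega⟩) (by simp only [h1]; omega), h1,
      sq_add_four_le_iff hM hq']
    · exact hle
    · intro i hi
      rw [Ne, Fin.ext_iff] at hi
      simp only at hi
      rw [(h i).1 (by omega)]

/-- Three large residue fields leave room for no ramification, and bound the largest one by `4`. -/
lemma orders_of_three_factors {M a b c : ℕ} (hM : 1 ≤ M) (ha : 2 ≤ a) (hab : a ≤ b) (hbc : b ≤ c)
    (h : (M * (b * c)) ^ 2 + 4 ≤ 4 * (M * (a * (b * c)))) :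
    M = 1 ∧ (a = 2 ∧ b = 2 ∧ c = 2 ∨ a = 2 ∧ b = 2 ∧ c = 3 ∨ a = 3 ∧ b = 3 ∧ c = 3) := by
  have h4 : M * c < 4 := by
    by_contra! h4
    have : 4 * (M * (a * (b * c))) ≤ (M * (b * c)) ^ 2 := by
      calc 4 * (M * (a * (b * c))) ≤ (M * c) * (M * (b * (b * c))) := by gcongr
        _ = (M * (b * c)) ^ 2 := by ring
    omega
  have hM1 : M = 1 := by
    by_contra hne
    have : 2 * 2 ≤ M * c := Nat.mul_le_mul (by omega) (by omega)
    omega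
  subst hM1
  refine ⟨rfl, ?_⟩
  have hc : c ≤ 3 := by omega
  interval_cases c <;> interval_cases b <;> interval_cases a <;> omega

lemma prod_lt_four_of_two_factors {M a b : ℕ} (hab : a ≤ b)
    (h : (M * b) ^ 2 + 4 ≤ 4 * (M * b * a)) : M < 4 := by
  by_contra! h4
  have : 4 * (M * b * a) ≤ (M * b) ^ 2 := by
    calc 4 * (M * b * a) ≤ M * (M * b * b) := by gcongr
      _ = (M * b) ^ 2 := by ring
  omega

/-- The families arise by counting the residue fields of order at least `3`. With two of them the
product of the `m i` is at most `3`, and a value `2` or `3` comes from a single factor, which is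
moved to the place where the classification lists it. -/
lemma RamanujanCriterion.exists_admissibleOrders (hs : 2 ≤ s) (hm : ∀ i, 1 ≤ m i)
    (hq2 : ∀ i, 2 ≤ q i) (hdvd : ∀ i, m i ≠ 1 → q i ∣ m i) (hmono : Monotone q)
    (h : RamanujanCriterion m (fun i => q i - 1)) :
    ∃ σ : Equiv.Perm (Fin s), (∀ i, q (σ i) = q i) ∧ AdmissibleOrders (m ∘ σ) (q ∘ σ) := by
  have hM : 1 ≤ ∏ i, m i := Finset.one_le_prod' fun i _ => hm i
  have hle : ∀ {i j : Fin s}, (i : ℕ) ≤ j → q i ≤ q j := fun {i j} hij => hmono hij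
  have hlow : ∀ k : Fin s, q k < 3 → ∀ i : Fin s, (i : ℕ) ≤ k → q i = 2 := by
    intro k hk i hi
    have := hle hi
    have := hq2 i
    omega
  by_cases h1 : q ⟨s - 1, by omega⟩ < 3
  · refine ⟨1, fun _ => rfl, Or.inl fun i => hlow _ h1 i ?_⟩
    simp only
    omega
  by_cases h2 : q ⟨s - 2, by omega⟩ < 3
  · have hlow2 := hlow _ h2
    refine ⟨1, fun _ => rfl, ?_⟩
    iterate 7 right
    refine ⟨q ⟨s - 1, by omega⟩, by omega, fun i => ⟨fun hi => hlow2 i (by simp only; omega),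
      fun hi => congrArg q (Fin.ext (by simp only [Equiv.Perm.coe_one, id]; omega))⟩, ?_⟩
    rw [ramanujanCriterion_iff_of_one (a := ⟨s - 1, by omega⟩) (by omega)] at h
    · rw [sq_add_four_le_iff hM (by omega)] at h
      exact h
    · intro i hi
      rw [Ne, Fin.ext_iff] at hi
      simp only at hi
      rw [hlow2 i (by simp only; omega)]
  have h21 : q ⟨s - 2, by omega⟩ ≤ q ⟨s - 1, by omega⟩ := hle (by simp only; omega)
  by_cases hlow3 : ∀ i : Fin s, (i : ℕ) + 1 ≤ s - 2 → q i = 2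
  · rw [ramanujanCriterion_iff_of_last_two hs hlow3 (by omega) h21 rfl rfl] at h
    have hM4 := prod_lt_four_of_two_factors (by omega) h
    generalize hMdef : ∏ i, m i = M at *
    interval_cases M
    · have hone : ∀ i, m i = 1 := fun i => Finset.prod_eq_one_iff.1 hMdef i (Finset.mem_univ i)
      refine ⟨1, fun _ => rfl, ?_⟩
      iterate 6 right
      left
      refine ⟨q ⟨s - 2, by omega⟩, q ⟨s - 1, by omega⟩, by omega, by omega, h21, ?_, fun i =>
        ⟨fun hi => ⟨hone i, hlow3 i hi⟩,
         fun hi => ⟨hone i, congrArg q (Fin.ext (by simp only [Equiv.Perm.coe_one, id]; omega))⟩,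
         fun hi => ⟨hone i, congrArg q (Fin.ext (by simp only [Equiv.Perm.coe_one, id]; omega))⟩⟩⟩
      rw [sq_add_four_le_iff (by omega) (by omega)] at h
      push_cast [Nat.cast_sub (show 1 ≤ q ⟨s - 1, by omega⟩ by omega)] at h
      linarith
    · obtain ⟨k, hk, hk'⟩ := exists_eq_prime_of_prod_eq_prime Nat.prime_two hMdef
      have hqk : q k = 2 := by
        have := Nat.le_of_dvd (by omega) (hdvd k (by omega))
        have := hq2 k
        omega
      have hks : (k : ℕ) + 1 ≤ s - 2 := by
        by_contra! hlt
        have : q ⟨s - 2, by omega⟩ ≤ q k := hle (by simp only; omega)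
        omega
      -- The ramified factor has `q k = 2`, so it may trade places with the first factor.
      have hq0 : q ⟨0, by omega⟩ = q k := by
        rw [hqk, hlow3 _ (by simp only; omega)]
      have hσ := apply_swap_eq_of_eq hq0
      refine ⟨Equiv.swap ⟨0, by omega⟩ k, hσ, ?_⟩
      iterate 5 right
      left
      have hone : ∀ i : Fin s, 2 ≤ (i : ℕ) + 1 → m (Equiv.swap ⟨0, by omega⟩ k i) = 1 := by
        intro i hi
        apply hk'
        rw [Ne, Equiv.swap_apply_eq_iff, Equiv.swap_apply_right, Fin.ext_iff]
        simp only
        omega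
      refine ⟨by omega, q ⟨s - 2, by omega⟩, q ⟨s - 1, by omega⟩, by omega, by omega, h21, ?_,
        fun i => ⟨fun hi => ?_, fun hi hi' => ⟨hone i hi, (hσ i).trans (hlow3 i hi')⟩,
          fun hi => ⟨hone i (by omega), (hσ i).trans
            (congrArg q (Fin.ext (by simp only; omega)))⟩,
          fun hi => ⟨hone i (by omega), (hσ i).trans
            (congrArg q (Fin.ext (by simp only; omega)))⟩⟩⟩
      · rw [sq_add_four_le_iff (by omega) (by omega)] at h
        push_cast [Nat.cast_sub (show 1 ≤ q ⟨s - 1, by omega⟩ by omega)] at h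
        linarith
      · have hi0 : i = ⟨0, by omega⟩ := Fin.ext (by simp only; omega)
        simp only [Function.comp_apply, hi0, Equiv.swap_apply_left]
        exact ⟨hk, hqk⟩
    · obtain ⟨k, hk, hk'⟩ := exists_eq_prime_of_prod_eq_prime Nat.prime_three hMdef
      have hqk : q k = 3 := by
        have hd := hdvd k (by omega)
        rw [hk, Nat.dvd_prime Nat.prime_three] at hd
        have := hq2 k
        omega
      have hks : s - 2 ≤ (k : ℕ) := by
        by_contra! hlt
        have := hlow3 k (by omega)
        omega
      have hq₁ : q ⟨s - 2, by omega⟩ = 3 := by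
        have : q ⟨s - 2, by omega⟩ ≤ q k := hle hks
        omega
      have hq₂ : q ⟨s - 1, by omega⟩ = 3 := by
        rw [hq₁] at h
        have hlt : q ⟨s - 1, by omega⟩ < 4 := by
          by_contra! hge
          obtain ⟨c, hc⟩ := Nat.exists_eq_add_of_le hge
          rw [hc, show 4 + c - 1 = 3 + c by omega] at h
          norm_num at h
          nlinarith
        omega
      -- The ramified factor is one of the last two, both with residue field of order `3`.
      have hqs : q ⟨s - 1, by omega⟩ = q k := by rw [hqk, hq₂]
      have hσ := apply_swap_eq_of_eq hqs
      have hone : ∀ i : Fin s, (i : ℕ) + 1 ≤ s - 1 →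
          m (Equiv.swap ⟨s - 1, by omega⟩ k i) = 1 := by
        intro i hi
        apply hk'
        rw [Ne, Equiv.swap_apply_eq_iff, Equiv.swap_apply_right, Fin.ext_iff]
        simp only
        omega
      refine ⟨Equiv.swap ⟨s - 1, by omega⟩ k, hσ, ?_⟩
      iterate 4 right
      left
      refine fun i => ⟨fun hi => ⟨hone i (by omega), (hσ i).trans (hlow3 i hi)⟩,
        fun hi => ⟨hone i (by omega), (hσ i).trans ?_⟩, fun hi => ?_⟩
      · rw [← hq₁]
        exact congrArg q (Fin.ext (by simp only; omega))
      · have hi1 : i = ⟨s - 1, by omega⟩ := Fin.ext (by simp only; omega)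
        simp only [Function.comp_apply, hi1, Equiv.swap_apply_left]
        exact ⟨hk, hqk⟩
  · push Not at hlow3
    obtain ⟨k, hk, hk2⟩ := hlow3
    have hs3 : 3 ≤ s := by omega
    have h3 : 3 ≤ q ⟨s - 3, by omega⟩ := by
      have : q k ≤ q ⟨s - 3, by omega⟩ := hle (by simp only; omega)
      have := hq2 k
      omega
    have h32 : q ⟨s - 3, by omega⟩ ≤ q ⟨s - 2, by omega⟩ := hle (by simp only; omega)
    by_cases hlow4 : ∀ i : Fin s, (i : ℕ) + 1 ≤ s - 3 → q i = 2
    · rw [ramanujanCriterion_iff_of_three (a := ⟨s - 3, by omega⟩) (b := ⟨s - 2, by omega⟩)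
        (c := ⟨s - 1, by omega⟩) (by simp only [Ne, Fin.ext_iff]; omega)
        (by simp only [Ne, Fin.ext_iff]; omega) (by simp only [Ne, Fin.ext_iff]; omega)
        (by omega) (by omega) (by omega)] at h
      · obtain ⟨hMone, habc⟩ := orders_of_three_factors hM (by omega) (by omega) (by omega) h
        have hone : ∀ i, m i = 1 := fun i => Finset.prod_eq_one_iff.1 hMone i (Finset.mem_univ i)
        have hcases : ∀ i : Fin s, s - 2 ≤ (i : ℕ) + 1 → i = ⟨s - 3, by omega⟩ ∨
            i = ⟨s - 2, by omega⟩ ∨ i = ⟨s - 1, by omega⟩ := by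
          intro i hi
          simp only [Fin.ext_iff]
          omega
        refine ⟨1, fun _ => rfl, ?_⟩
        rcases habc with ⟨ha, hb, hc⟩ | ⟨ha, hb, hc⟩ | ⟨ha, hb, hc⟩
        · iterate 1 right
          left
          refine ⟨hs3, fun i => ⟨fun hi => ⟨hone i, hlow4 i hi⟩, fun hi => ⟨hone i, ?_⟩⟩⟩
          rcases hcases i hi with rfl | rfl | rfl <;>
            simp only [Function.comp_apply, Equiv.Perm.coe_one, id] <;> omega
        · iterate 2 right
          left
          refine ⟨hs3, fun i => ⟨fun hi => ⟨hone i, hlow4 i hi⟩, fun hi => ⟨hone i, ?_⟩,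
            fun hi => ⟨hone i, ?_⟩⟩⟩
          · rcases hcases i (by omega) with rfl | rfl | rfl <;>
              simp only [Function.comp_apply, Equiv.Perm.coe_one, id] at hi ⊢ <;> omega
          · rcases hcases i (by omega) with rfl | rfl | rfl <;>
              simp only [Function.comp_apply, Equiv.Perm.coe_one, id] at hi ⊢ <;> omega
        · iterate 3 right
          left
          refine ⟨hs3, fun i => ⟨fun hi => ⟨hone i, hlow4 i hi⟩, fun hi => ⟨hone i, ?_⟩⟩⟩
          rcases hcases i hi with rfl | rfl | rfl <;>
            simp only [Function.comp_apply, Equiv.Perm.coe_one, id] <;> omega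
      · intro i hi3 hi2 hi1
        rw [Ne, Fin.ext_iff] at hi1 hi2 hi3
        simp only at hi1 hi2 hi3
        rw [hlow4 i (by omega)]
    · push Not at hlow4
      obtain ⟨l, hl, hl2⟩ := hlow4
      have h4 : 3 ≤ q l := by
        have := hq2 l
        omega
      have h43 : q l ≤ q ⟨s - 3, by omega⟩ := hle (by simp only; omega)
      refine absurd h (not_ramanujanCriterion_of_four (a := l) (b := ⟨s - 3, by omega⟩)
        (c := ⟨s - 2, by omega⟩) (d := ⟨s - 1, by omega⟩) ?_ ?_ ?_ ?_ ?_ ?_ hm ?_ ?_ ?_ ?_ ?_)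
      all_goals try simp only [Ne, Fin.ext_iff]
      case refine_7 =>
        intro i
        have := hq2 i
        omega
      all_goals omega

end Classification

/-! ### Translation to isomorphism types -/

section Translation

variable {A : Type*} [CommRing A] [IsLocalRing A] [Finite A]

lemma isoFiniteField_residueField_iff {k : ℕ} :
    IsoFiniteField (IsLocalRing.ResidueField A) k ↔
      Nat.card (IsLocalRing.ResidueField A) = k :=
  ⟨fun h => h.natCard_eq, fun h => h ▸ exists_isoFiniteField_card _⟩

lemma isoFiniteField_iff {k : ℕ} : IsoFiniteField A k ↔
    maxIdealCard A = 1 ∧ Nat.card (IsLocalRing.ResidueField A) = k :=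
  ⟨maxIdealCard_and_card_residueField_of_isoFiniteField,
    fun h => h.2 ▸ isoFiniteField_of_maxIdealCard_eq_one h.1⟩

lemma ringEquiv_zmod_four_or_iff :
    (Nonempty (A ≃+* ZMod 4) ∨
      Nonempty (A ≃+* (ZMod 2)[X] ⧸ Ideal.span {(X : (ZMod 2)[X]) ^ 2})) ↔
      maxIdealCard A = 2 ∧ Nat.card (IsLocalRing.ResidueField A) = 2 :=
  ⟨maxIdealCard_eq_of_ringEquiv (p := 2), fun h => ringEquiv_of_maxIdealCard_eq_prime h.1 h.2⟩

lemma ringEquiv_zmod_nine_or_iff :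
    (Nonempty (A ≃+* ZMod 9) ∨
      Nonempty (A ≃+* (ZMod 3)[X] ⧸ Ideal.span {(X : (ZMod 3)[X]) ^ 2})) ↔
      maxIdealCard A = 3 ∧ Nat.card (IsLocalRing.ResidueField A) = 3 :=
  have : Fact (Nat.Prime 3) := ⟨Nat.prime_three⟩
  ⟨maxIdealCard_eq_of_ringEquiv (p := 3), fun h => ringEquiv_of_maxIdealCard_eq_prime h.1 h.2⟩

end Translation

/-- The factor in position `k` (counted from `1`) is `R i` with `(i : ℕ) + 1 = k`. The permutation
`σ` reorders factors whose residue fields have the same order. -/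
theorem theorem3p2 {s : ℕ} (hs : 2 ≤ s) (R : Fin s → Type*) [∀ i, CommRing (R i)]
    [∀ i, IsLocalRing (R i)] [∀ i, Fintype (R i)]
    (hord : ∀ i j : Fin s, i ≤ j → cardRatio (R i) ≤ cardRatio (R j)) :
    IsRamanujanGraph (unitaryCayleyGraph (∀ i, R i)) ↔
      ∃ σ : Equiv.Perm (Fin s), (∀ i, cardRatio (R (σ i)) = cardRatio (R i)) ∧
        ( -- (a)
          (∀ i, IsoFiniteField (IsLocalRing.ResidueField (R (σ i))) 2) ∨
          -- (b)
          (3 ≤ s ∧ ∀ i : Fin s,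
            ((i : ℕ) + 1 ≤ s - 3 → IsoFiniteField (R (σ i)) 2) ∧
            (s - 2 ≤ (i : ℕ) + 1 → IsoFiniteField (R (σ i)) 3)) ∨
          -- (c)
          (3 ≤ s ∧ ∀ i : Fin s,
            ((i : ℕ) + 1 ≤ s - 3 → IsoFiniteField (R (σ i)) 2) ∧
            ((i : ℕ) + 1 = s - 2 ∨ (i : ℕ) + 1 = s - 1 → IsoFiniteField (R (σ i)) 3) ∧
            ((i : ℕ) + 1 = s → IsoFiniteField (R (σ i)) 4)) ∨
          -- (d)
          (3 ≤ s ∧ ∀ i : Fin s,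
            ((i : ℕ) + 1 ≤ s - 3 → IsoFiniteField (R (σ i)) 2) ∧
            (s - 2 ≤ (i : ℕ) + 1 → IsoFiniteField (R (σ i)) 4)) ∨
          -- (e)
          (∀ i : Fin s,
            ((i : ℕ) + 1 ≤ s - 2 → IsoFiniteField (R (σ i)) 2) ∧
            ((i : ℕ) + 1 = s - 1 → IsoFiniteField (R (σ i)) 3) ∧
            ((i : ℕ) + 1 = s →
              Nonempty (R (σ i) ≃+* ZMod 9) ∨
              Nonempty (R (σ i) ≃+* (ZMod 3)[X] ⧸ Ideal.span {(X : (ZMod 3)[X]) ^ 2}))) ∨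
          -- (f)
          (3 ≤ s ∧ ∃ q₁ q₂ : ℕ, 3 ≤ q₁ ∧ 3 ≤ q₂ ∧
            q₁ ≤ q₂ ∧ (q₂ : ℝ) ≤ q₁ + Real.sqrt (((q₁ : ℝ) - 2) * q₁) ∧
            ∀ i : Fin s,
              ((i : ℕ) + 1 = 1 →
                Nonempty (R (σ i) ≃+* ZMod 4) ∨
                Nonempty (R (σ i) ≃+* (ZMod 2)[X] ⧸ Ideal.span {(X : (ZMod 2)[X]) ^ 2})) ∧
              (2 ≤ (i : ℕ) + 1 → (i : ℕ) + 1 ≤ s - 2 → IsoFiniteField (R (σ i)) 2) ∧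
              ((i : ℕ) + 1 = s - 1 → IsoFiniteField (R (σ i)) q₁) ∧
              ((i : ℕ) + 1 = s → IsoFiniteField (R (σ i)) q₂)) ∨
          -- (g)
          (∃ q₁ q₂ : ℕ, 3 ≤ q₁ ∧ 3 ≤ q₂ ∧
            q₁ ≤ q₂ ∧ (q₂ : ℝ) ≤ 2 * (q₁ + Real.sqrt (((q₁ : ℝ) - 2) * q₁)) - 1 ∧
            ∀ i : Fin s,
              ((i : ℕ) + 1 ≤ s - 2 → IsoFiniteField (R (σ i)) 2) ∧
              ((i : ℕ) + 1 = s - 1 → IsoFiniteField (R (σ i)) q₁) ∧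
              ((i : ℕ) + 1 = s → IsoFiniteField (R (σ i)) q₂)) ∨
          -- (h)
          (∃ q : ℕ, 3 ≤ q ∧
            (∀ i : Fin s,
              ((i : ℕ) + 1 ≤ s - 1 → IsoFiniteField (IsLocalRing.ResidueField (R (σ i))) 2) ∧
              ((i : ℕ) + 1 = s → IsoFiniteField (IsLocalRing.ResidueField (R (σ i))) q)) ∧
            ((∏ i, maxIdealCard (R (σ i)) : ℕ) : ℝ) ≤
              2 * ((q : ℝ) - 1 + Real.sqrt (((q : ℝ) - 2) * q)))) := by
  have hne : Nonempty (Fin s) := ⟨⟨0, by omega⟩⟩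
  simp only [cardRatio_eq, Nat.cast_le, Nat.cast_inj] at hord ⊢
  -- The residue fields go first, since they also match the rewriting rule for local rings.
  simp only [isoFiniteField_residueField_iff]
  simp only [isoFiniteField_iff, ringEquiv_zmod_four_or_iff, ringEquiv_zmod_nine_or_iff]
  rw [isRamanujanGraph_unitaryCayleyGraph_pi_iff]
  set m : Fin s → ℕ := fun i => maxIdealCard (R i) with hm
  set q : Fin s → ℕ := fun i => Nat.card (IsLocalRing.ResidueField (R i)) with hq
  have hm1 : ∀ i, 1 ≤ m i := fun i => maxIdealCard_pos
  constructor
  · intro h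
    exact h.exists_admissibleOrders hs hm1 (fun i => two_le_card_residueField)
      (fun i hi => card_residueField_dvd_maxIdealCard hi) (fun i j hij => hord i j hij)
  · rintro ⟨σ, -, hadm⟩
    have hadm' : AdmissibleOrders (m ∘ σ) (q ∘ σ) := hadm
    exact ramanujanCriterion_comp_perm σ
      (hadm'.ramanujanCriterion hs fun i => hm1 (σ i))
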